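/- **Theorem 3.** Let $F$ be a field of characteristic different from $2$. All algebras below are (not necessarily associative or unital) $F$-algebras, and ideals are two-sided ideals that are $F$-subspaces. An algebra $A$ is a *Novikov algebra* if $(x,y,z)=(y,x,z)$ and $(xy)z=(xz)y$ for all $x,y,z\in A$, where $(x,y,z)=(xy)z-x(yz)$. It is *Lie-solvable* if $A^{(n)_L}=0$ for some $n\ge 0$, where $A^{(0)_L}=A$ and $A^{(n+1)_L}$ is the subspace spanned by all commutators $ab-ba$ with $a,b\in A^{(n)_L}$. An algebra $A$ is *left-quasiregular* if for every $x\in A$ there is $y\in A$ with $x+y=yx$; an ideal is called left-quasiregular if it is so as an algebra. The *heart* of an algebra is the intersection of all its nonzero ideals; an algebra is *subdirectly irreducible* if its heart $H$ is nonzero, and its heart is *idempotent* if $H^2=H$ (where $H^2$ is the span of all products of two elements of $H$). A Novikov algebra is *Andrunakievich-radical* ($\mathcal A$-radical) if it has no homomorphism onto a subdirectly irreducible Novikov algebra with idempotent heart; an ideal is called $\mathcal A$-radical if it is so as an algebra. Let $A$ be a Lie-solvable Novikov algebra over $F$. Then: 1. $A$ is left-quasiregular if and only if $A$ is $\mathcal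 A$-radical. Thus, in the class of Lie-solvable Novikov algebras, the left-quasiregular algebras are exactly the $\mathcal A$-radical algebras. 2. The sum $J(A)$ of all left-quasiregular ideals of $A$ is a left-quasiregular ideal, and the quotient algebra $A/J(A)$ has no nonzero left-quasiregular ideals. 3. $J(A)$ is the Andrunakievich radical of $A$, that is, the largest $\mathcal A$-radical ideal of $A$. -/

import Mathlib

universe u v

namespace NovikovRadicals

/-- Novikov algebras: the associator is left-symmetric and right multiplications commute. -/
def IsNovikov (A : Type u) [NonUnitalNonAssocRing A] : Prop :=
  (∀ x y z : A, associator x y z = associator y x z) ∧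
    ∀ x y z : A, (x * y) * z = (x * z) * y

/-- Every `x` has some `y` with `x + y = y x`. -/
def IsLeftQuasiregular (A : Type u) [NonUnitalNonAssocRing A] : Prop :=
  ∀ x : A, ∃ y : A, x + y = y * x

section Defs

variable (F : Type v) [Field F] (A : Type u) [NonUnitalNonAssocRing A] [Module F A]

/-- The Lie-solvable powers: the whole algebra, then repeatedly the subspace spanned by all
commutators of elements of the previous term. -/
def liePower : ℕ → Submodule F A
  | 0 => ⊤
  | n + 1 => Submodule.span F
      {c : A | ∃ a ∈ liePower n, ∃ b ∈ liePower n, c = a * b - b * a}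

/-- Some Lie-solvable power vanishes. -/
def IsLieSolvable : Prop := ∃ n : ℕ, liePower F A n = ⊥

/-- Two-sided ideals of the `F`-algebra `A`: subspaces absorbing multiplication on both sides. -/
structure AlgIdeal extends Submodule F A where
  mul_mem_left : ∀ (a : A) {x : A}, x ∈ toSubmodule → a * x ∈ toSubmodule
  mul_mem_right : ∀ (a : A) {x : A}, x ∈ toSubmodule → x * a ∈ toSubmodule

/-- The heart: the intersection of all nonzero ideals. -/
def heart : Submodule F A :=
  sInf {H : Submodule F A | ∃ I : AlgIdeal F A, I.toSubmodule ≠ ⊥ ∧ H = I.toSubmodule}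

/-- The heart is nonzero (in the zero algebra the intersection is the zero algebra itself, so the
zero algebra is not subdirectly irreducible). -/
def IsSubdirectlyIrreducible : Prop := heart F A ≠ ⊥

/-- The heart `H` satisfies `H * H = H`, where `H * H` is spanned by all products. -/
def HasIdempotentHeart : Prop :=
  Submodule.span F {c : A | ∃ a ∈ heart F A, ∃ b ∈ heart F A, c = a * b} = heart F A

/-- The subdirectly irreducible Novikov algebras with idempotent heart. -/
def IsIrreducibleWithIdempotentHeart : Prop :=
  IsNovikov A ∧ IsSubdirectlyIrreducible F A ∧ HasIdempotentHeart F A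

/-- Andrunakievich-radical Novikov algebras: those without a surjective homomorphism onto a
subdirectly irreducible Novikov algebra with idempotent heart. A homomorphic image of `A` always
has a copy in the universe of `A`. -/
def IsAndrunakievichRadical : Prop :=
  IsNovikov A ∧
    ∀ (B : Type u) [NonUnitalNonAssocRing B] [Module F B] [IsScalarTower F B B]
      [SMulCommClass F B B] (f : A →ₙₐ[F] B),
      Function.Surjective f → ¬ IsIrreducibleWithIdempotentHeart F B

end Defs

section Ideals

variable {F : Type v} [Field F] {A : Type u} [NonUnitalNonAssocRing A] [Module F A]

/-- An ideal as an algebra in its own right. -/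
def AlgIdeal.toSubalgebra (I : AlgIdeal F A) : NonUnitalSubalgebra F A :=
  { I.toSubmodule with
    mul_mem' := fun {a _} _ hb => I.mul_mem_left a hb }

/-- The quotient algebra of `A` by an ideal. -/
def AlgIdeal.Quotient (I : AlgIdeal F A) : Type u := A ⧸ I.toSubmodule

instance (I : AlgIdeal F A) : AddCommGroup I.Quotient :=
  inferInstanceAs (AddCommGroup (A ⧸ I.toSubmodule))

instance (I : AlgIdeal F A) : Module F I.Quotient :=
  inferInstanceAs (Module F (A ⧸ I.toSubmodule))

/-- The class of an element in the quotient algebra. -/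
def AlgIdeal.proj (I : AlgIdeal F A) : A →ₗ[F] I.Quotient := I.toSubmodule.mkQ

theorem AlgIdeal.proj_surjective (I : AlgIdeal F A) : Function.Surjective I.proj :=
  Submodule.mkQ_surjective _

theorem AlgIdeal.proj_eq_proj_iff (I : AlgIdeal F A) (a b : A) :
    I.proj a = I.proj b ↔ a - b ∈ I.toSubmodule :=
  Submodule.Quotient.eq _

instance (I : AlgIdeal F A) : Mul I.Quotient :=
  ⟨Quotient.map₂ (· * ·) (by
    intro a a' h b b' h'
    have h1 : a - a' ∈ I.toSubmodule := (Submodule.quotientRel_def _).1 h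
    have h2 : b - b' ∈ I.toSubmodule := (Submodule.quotientRel_def _).1 h'
    refine (Submodule.quotientRel_def _).2 ?_
    have e : a * b - a' * b' = (a - a') * b + a' * (b - b') := by
      rw [sub_mul, mul_sub]; abel
    rw [e]
    exact I.toSubmodule.add_mem (I.mul_mem_right _ h1) (I.mul_mem_left _ h2))⟩

theorem AlgIdeal.proj_mul (I : AlgIdeal F A) (a b : A) : I.proj (a * b) = I.proj a * I.proj b := rfl

instance (I : AlgIdeal F A) : NonUnitalNonAssocRing I.Quotient :=
  { (inferInstance : AddCommGroup I.Quotient), (inferInstance : Mul I.Quotient) with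
    left_distrib := by
      intro a b c
      obtain ⟨a, rfl⟩ := I.proj_surjective a
      obtain ⟨b, rfl⟩ := I.proj_surjective b
      obtain ⟨c, rfl⟩ := I.proj_surjective c
      simp only [← map_add, ← AlgIdeal.proj_mul, mul_add]
    right_distrib := by
      intro a b c
      obtain ⟨a, rfl⟩ := I.proj_surjective a
      obtain ⟨b, rfl⟩ := I.proj_surjective b
      obtain ⟨c, rfl⟩ := I.proj_surjective c
      simp only [← map_add, ← AlgIdeal.proj_mul, add_mul]
    zero_mul := by
      intro a
      obtain ⟨a, rfl⟩ := I.proj_surjective a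
      rw [← map_zero I.proj, ← AlgIdeal.proj_mul, zero_mul]
    mul_zero := by
      intro a
      obtain ⟨a, rfl⟩ := I.proj_surjective a
      rw [← map_zero I.proj, ← AlgIdeal.proj_mul, mul_zero] }

instance [IsScalarTower F A A] (I : AlgIdeal F A) : IsScalarTower F I.Quotient I.Quotient :=
  ⟨by
    intro c a b
    obtain ⟨a, rfl⟩ := I.proj_surjective a
    obtain ⟨b, rfl⟩ := I.proj_surjective b
    simp only [smul_eq_mul, ← map_smul, ← AlgIdeal.proj_mul, smul_mul_assoc]⟩

instance [SMulCommClass F A A] (I : AlgIdeal F A) : SMulCommClass F I.Quotient I.Quotient :=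
  ⟨by
    intro c a b
    obtain ⟨a, rfl⟩ := I.proj_surjective a
    obtain ⟨b, rfl⟩ := I.proj_surjective b
    simp only [smul_eq_mul, ← map_smul, ← AlgIdeal.proj_mul, mul_smul_comm]⟩

variable (F A)

/-- The sum of all left-quasiregular ideals. -/
def quasiregularRadical : AlgIdeal F A where
  toSubmodule :=
    sSup {S : Submodule F A | ∃ I : AlgIdeal F A,
      IsLeftQuasiregular I.toSubalgebra ∧ S = I.toSubmodule}
  mul_mem_left := by
    intro a x hx
    rw [sSup_eq_iSup'] at hx ⊢
    refine Submodule.iSup_induction _ (motive := fun x => a * x ∈ _) hx ?_ ?_ ?_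
    · rintro ⟨S, I, hI, rfl⟩ x hx
      exact Submodule.mem_iSup_of_mem (⟨I.toSubmodule, I, hI, rfl⟩ :
        {S : Submodule F A | ∃ I : AlgIdeal F A,
          IsLeftQuasiregular I.toSubalgebra ∧ S = I.toSubmodule}) (I.mul_mem_left a hx)
    · rw [mul_zero]; exact Submodule.zero_mem _
    · intro x y hx hy
      rw [mul_add]; exact Submodule.add_mem _ hx hy
  mul_mem_right := by
    intro a x hx
    rw [sSup_eq_iSup'] at hx ⊢
    refine Submodule.iSup_induction _ (motive := fun x => x * a ∈ _) hx ?_ ?_ ?_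
    · rintro ⟨S, I, hI, rfl⟩ x hx
      exact Submodule.mem_iSup_of_mem (⟨I.toSubmodule, I, hI, rfl⟩ :
        {S : Submodule F A | ∃ I : AlgIdeal F A,
          IsLeftQuasiregular I.toSubalgebra ∧ S = I.toSubmodule}) (I.mul_mem_right a hx)
    · rw [zero_mul]; exact Submodule.zero_mem _
    · intro x y hx hy
      rw [add_mul]; exact Submodule.add_mem _ hx hy

end Ideals

end NovikovRadicals

/-! Write `C` for the span of all commutators and `P x` for the operator `a ↦ a - a * x`; then `x`
is left quasiregular exactly when it lies in the range of `P x`.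

In characteristic different from `2` the Lie-solvable powers are ideals, and the product of the
square of the `n`-th one with `C` lies in the `(n+1)`-st. Since an ideal is right nilpotent as soon
as its square is, Lie-solvability makes `C` right nilpotent. If `x` is quasiregular modulo `C`, then
each right power of `C` lies in the range of `P x` up to the next right power, so `C` itself lies in
that range: quasiregularity can be tested in the commutative associative quotient `A / C`. There it
passes from `x + y - y * x` to `x`, which gives the closure properties of `J(A)`.

A subdirectly irreducible image with idempotent heart cannot contain a nonzero right nilpotent
ideal, so it is commutative and associative, and its heart contains a relative unit, which is not
quasiregular. Conversely, if `x` is not quasiregular, then the range of `P x` together with `C` is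
an ideal avoiding `x`, and modulo a maximal such ideal `x` becomes a right identity lying in every
nonzero ideal. -/

universe w

namespace NovikovRadicals

section Identities

variable {A : Type u} [NonUnitalNonAssocRing A]

theorem IsNovikov.associator_left_symm (hN : IsNovikov A) (x y z : A) :
    (x * y) * z - x * (y * z) = (y * x) * z - y * (x * z) :=
  hN.1 x y z

theorem IsNovikov.mul_right_comm (hN : IsNovikov A) (x y z : A) : (x * y) * z = (x * z) * y :=
  hN.2 x y z

theorem IsNovikov.two_nsmul_lie_mul (hN : IsNovikov A) (a b c : A) :
    2 • (⁅a, b⁆ * c) = ⁅a * c, b⁆ + ⁅a, b * c⁆ := by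
  simp only [Ring.lie_def, sub_mul]
  linear_combination (norm := abel)
    hN.associator_left_symm a b c + hN.mul_right_comm a b c - hN.mul_right_comm b a c

theorem IsNovikov.mul_lie (hN : IsNovikov A) (c a b : A) :
    c * ⁅a, b⁆ = ⁅a, b⁆ * c + (⁅⁅c, a⁆, b⁆ + ⁅a, ⁅c, b⁆⁆) := by
  simp only [Ring.lie_def, sub_mul, mul_sub]
  linear_combination (norm := abel) -hN.associator_left_symm c a b +
    hN.associator_left_symm c b a - hN.associator_left_symm a b c

theorem IsNovikov.associator_eq_lie_mul_sub_lie (hN : IsNovikov A) (a b c : A) :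
    associator a b c = ⁅a, b⁆ * c - ⁅a, b * c⁆ := by
  simp only [associator_apply, Ring.lie_def, sub_mul]
  linear_combination (norm := abel) -hN.mul_right_comm b c a

theorem IsNovikov.associator_mul_swap (hN : IsNovikov A) (i j a b : A) :
    associator (i * j) a b = associator (a * j) i b := by
  have h := congrArg (· * j) (hN.associator_left_symm i a b)
  simp only [sub_mul] at h
  simp only [associator_apply]
  rwa [hN.mul_right_comm i j a, hN.mul_right_comm _ j b, hN.mul_right_comm i j,
    hN.mul_right_comm a j i, hN.mul_right_comm _ j b, hN.mul_right_comm a j]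

theorem IsNovikov.mul_mul_lie (hN : IsNovikov A) (i j a b : A) :
    (i * j) * ⁅a, b⁆ = associator (b * j) i a - associator (a * j) i b := by
  rw [← hN.associator_mul_swap i j b a, ← hN.associator_mul_swap i j a b]
  simp only [associator_apply, Ring.lie_def, mul_sub, hN.mul_right_comm (i * j) b a]
  abel

theorem IsNovikov.mul_assoc_of_comm (hN : IsNovikov A) (hcomm : ∀ a b : A, a * b = b * a)
    (a b c : A) : (a * b) * c = a * (b * c) := by
  rw [hcomm a (b * c), hN.mul_right_comm b c a, hcomm b a]

end Identities

section Ideals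

variable {F : Type v} [Field F] {A : Type u} [NonUnitalNonAssocRing A] [Module F A]

/-- The subspace `S` is a two-sided ideal: the unbundled form of `AlgIdeal`, for subspaces that are
constructed before they are known to be ideals. -/
structure IsIdeal (S : Submodule F A) : Prop where
  mul_mem_left : ∀ (a : A) {x : A}, x ∈ S → a * x ∈ S
  mul_mem_right : ∀ (a : A) {x : A}, x ∈ S → x * a ∈ S

/-- The bundled ideal with underlying subspace `S`, used to form quotients by `S`. -/
def IsIdeal.toAlgIdeal {S : Submodule F A} (hS : IsIdeal S) : AlgIdeal F A :=
  { S with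
    mul_mem_left := hS.mul_mem_left
    mul_mem_right := hS.mul_mem_right }

theorem AlgIdeal.isIdeal (I : AlgIdeal F A) : IsIdeal I.toSubmodule :=
  ⟨I.mul_mem_left, I.mul_mem_right⟩

theorem IsIdeal.heart_le {S : Submodule F A} (hS : IsIdeal S) (hne : S ≠ ⊥) : heart F A ≤ S :=
  sInf_le ⟨hS.toAlgIdeal, hne, rfl⟩

theorem isIdeal_heart : IsIdeal (heart F A) where
  mul_mem_left a x hx := by
    simp only [heart, Submodule.mem_sInf] at hx ⊢
    rintro _ ⟨I, hI, rfl⟩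
    exact I.mul_mem_left a (hx _ ⟨I, hI, rfl⟩)
  mul_mem_right a x hx := by
    simp only [heart, Submodule.mem_sInf] at hx ⊢
    rintro _ ⟨I, hI, rfl⟩
    exact I.mul_mem_right a (hx _ ⟨I, hI, rfl⟩)

theorem IsIdeal.comap {B : Type w} [NonUnitalNonAssocRing B] [Module F B] {S : Submodule F B}
    (hS : IsIdeal S) (f : A →ₙₐ[F] B) : IsIdeal (S.comap (f : A →ₗ[F] B)) where
  mul_mem_left a x hx := by
    change f (a * x) ∈ S
    exact map_mul f a x ▸ hS.mul_mem_left (f a) hx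
  mul_mem_right a x hx := by
    change f (x * a) ∈ S
    exact map_mul f x a ▸ hS.mul_mem_right (f a) hx

variable [IsScalarTower F A A] [SMulCommClass F A A]

theorem isIdeal_sSup {c : Set (Submodule F A)} (hc : ∀ S ∈ c, IsIdeal S) : IsIdeal (sSup c) where
  mul_mem_left a _ hx :=
    (sSup_le fun S hS _ hs => le_sSup hS ((hc S hS).mul_mem_left a hs) :
      sSup c ≤ (sSup c).comap (LinearMap.mulLeft F a)) hx
  mul_mem_right a _ hx :=
    (sSup_le fun S hS _ hs => le_sSup hS ((hc S hS).mul_mem_right a hs) :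
      sSup c ≤ (sSup c).comap (LinearMap.mulRight F a)) hx

theorem isIdeal_span {s : Set A} (hl : ∀ a, ∀ x ∈ s, a * x ∈ Submodule.span F s)
    (hr : ∀ a, ∀ x ∈ s, x * a ∈ Submodule.span F s) : IsIdeal (Submodule.span F s) where
  mul_mem_left a _ hx :=
    (Submodule.span_le.2 fun x hx => hl a x hx :
      Submodule.span F s ≤ (Submodule.span F s).comap (LinearMap.mulLeft F a)) hx
  mul_mem_right a _ hx :=
    (Submodule.span_le.2 fun x hx => hr a x hx :
      Submodule.span F s ≤ (Submodule.span F s).comap (LinearMap.mulRight F a)) hx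

theorem exists_maximal_isIdeal_notMem {S : Submodule F A} (hS : IsIdeal S) {x : A} (hx : x ∉ S) :
    ∃ W, S ≤ W ∧ Maximal (fun V : Submodule F A => IsIdeal V ∧ x ∉ V) W := by
  refine zorn_le_nonempty₀ {V : Submodule F A | IsIdeal V ∧ x ∉ V}
    (fun c hc hchain V hV => ⟨sSup c, ⟨isIdeal_sSup fun T hT => (hc hT).1, fun hxc => ?_⟩,
      fun T hT => le_sSup hT⟩) S ⟨hS, hx⟩
  obtain ⟨T, hT, hxT⟩ := (Submodule.mem_sSup_of_directed ⟨V, hV⟩ hchain.directedOn).1 hxc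
  exact (hc hT).2 hxT

end Ideals

section Products

variable {F : Type v} [Field F] {A : Type u} [NonUnitalNonAssocRing A] [Module F A]
  [IsScalarTower F A A] [SMulCommClass F A A]

/-- The product of two subspaces: the span of all products of their elements. Mathlib's
multiplication of submodules is only available for associative algebras. -/
scoped instance submoduleMul : Mul (Submodule F A) :=
  ⟨Submodule.map₂ (LinearMap.mul F A)⟩

theorem mul_mem_mul {S T : Submodule F A} {a b : A} (ha : a ∈ S) (hb : b ∈ T) : a * b ∈ S * T :=
  Submodule.apply_mem_map₂ (LinearMap.mul F A) ha hb

theorem mul_le_iff {S T U : Submodule F A} : S * T ≤ U ↔ ∀ a ∈ S, ∀ b ∈ T, a * b ∈ U :=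
  Submodule.map₂_le

theorem mul_mul_le_iff {S T U V : Submodule F A} :
    S * T * U ≤ V ↔ ∀ a ∈ S, ∀ b ∈ T, ∀ c ∈ U, a * b * c ∈ V := by
  refine ⟨fun h a ha b hb c hc => h (mul_mem_mul (mul_mem_mul ha hb) hc), fun h => ?_⟩
  refine mul_le_iff.2 fun x hx c hc => ?_
  have hST : S * T ≤ V.comap (LinearMap.mulRight F c) :=
    mul_le_iff.2 fun a ha b hb => h a ha b hb c hc
  exact hST hx

scoped instance : MulLeftMono (Submodule F A) :=
  ⟨fun _ _ _ h => Submodule.map₂_le_map₂_right h⟩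

scoped instance : MulRightMono (Submodule F A) :=
  ⟨fun _ _ _ h => Submodule.map₂_le_map₂_left h⟩

theorem sup_mul (S T U : Submodule F A) : (S ⊔ T) * U = S * U ⊔ T * U :=
  Submodule.map₂_sup_left _ S T U

theorem IsIdeal.mul_le_left {S T : Submodule F A} (hT : IsIdeal T) : S * T ≤ T :=
  mul_le_iff.2 fun a _ _ hb => hT.mul_mem_left a hb

theorem IsIdeal.mul_le_right {S T : Submodule F A} (hS : IsIdeal S) : S * T ≤ S :=
  mul_le_iff.2 fun _ ha b _ => hS.mul_mem_right b ha

theorem IsNovikov.submodule_mul_right_comm (hN : IsNovikov A) (S T U : Submodule F A) :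
    S * T * U = S * U * T := by
  have h (T U : Submodule F A) : S * T * U ≤ S * U * T :=
    mul_mul_le_iff.2 fun a ha b hb c hc =>
      hN.mul_right_comm a b c ▸ mul_mem_mul (mul_mem_mul ha hc) hb
  exact le_antisymm (h T U) (h U T)

theorem IsIdeal.mul (hN : IsNovikov A) {S T : Submodule F A} (hS : IsIdeal S) (hT : IsIdeal T) :
    IsIdeal (S * T) where
  mul_mem_left c x hx := by
    have h : S * T ≤ (S * T).comap (LinearMap.mulLeft F c) := by
      refine mul_le_iff.2 fun a ha b hb => ?_
      have e : c * (a * b) = (c * a) * b - (a * c) * b + a * (c * b) := by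
        linear_combination (norm := abel) -hN.associator_left_symm c a b
      rw [Submodule.mem_comap, LinearMap.mulLeft_apply, e]
      exact add_mem (sub_mem (mul_mem_mul (hS.mul_mem_left c ha) hb)
        (mul_mem_mul (hS.mul_mem_right c ha) hb)) (mul_mem_mul ha (hT.mul_mem_left c hb))
    exact h hx
  mul_mem_right c x hx := by
    have h : S * T ≤ (S * T).comap (LinearMap.mulRight F c) := by
      refine mul_le_iff.2 fun a ha b hb => ?_
      rw [Submodule.mem_comap, LinearMap.mulRight_apply, hN.mul_right_comm]
      exact mul_mem_mul (hS.mul_mem_right c ha) hb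
    exact h hx

theorem IsIdeal.mul_self_mul_le (hN : IsNovikov A) (K : Submodule F A) {M : Submodule F A}
    (hM : IsIdeal M) : K * K * M ≤ M * K := by
  rw [hN.submodule_mul_right_comm]
  exact mul_le_mul_left hM.mul_le_left K

end Products

section RightNilpotent

variable {F : Type v} [Field F] {A : Type u} [NonUnitalNonAssocRing A] [Module F A]
  [IsScalarTower F A A] [SMulCommClass F A A]

/-- The right powers `K`, `K * K`, `(K * K) * K`, … of a subspace; the indexing starts at `0`. -/
def rightPower (K : Submodule F A) : ℕ → Submodule F A
  | 0 => K
  | n + 1 => rightPower K n * K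

/-- Right nilpotency of a subspace: some right power vanishes. -/
def IsRightNilpotent (K : Submodule F A) : Prop := ∃ n, rightPower K n = ⊥

theorem rightPower_mono {K L : Submodule F A} (h : K ≤ L) (n : ℕ) :
    rightPower K n ≤ rightPower L n := by
  induction n with
  | zero => exact h
  | succ n ih => exact mul_le_mul' ih h

theorem IsRightNilpotent.mono {K L : Submodule F A} (h : K ≤ L) (hL : IsRightNilpotent L) :
    IsRightNilpotent K := by
  obtain ⟨n, hn⟩ := hL
  exact ⟨n, le_bot_iff.1 (hn ▸ rightPower_mono h n)⟩

theorem IsRightNilpotent.eq_bot_of_le_mul_self {S : Submodule F A} (hS : IsRightNilpotent S)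
    (h : S ≤ S * S) : S = ⊥ := by
  have le_rightPower (n : ℕ) : S ≤ rightPower S n := by
    induction n with
    | zero => exact le_rfl
    | succ n ih => exact h.trans (mul_le_mul_left ih S)
  obtain ⟨n, hn⟩ := hS
  exact le_bot_iff.1 (hn ▸ le_rightPower n)

theorem IsIdeal.rightPower (hN : IsNovikov A) {K : Submodule F A} (hK : IsIdeal K) (n : ℕ) :
    IsIdeal (rightPower K n) := by
  induction n with
  | zero => exact hK
  | succ n ih => exact ih.mul hN hK

theorem IsIdeal.mul_mul_mul_le (hN : IsNovikov A) {I M : Submodule F A} (hI : IsIdeal I)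
    (hM : IsIdeal M) : M * I * I * I ≤ I * I * M ⊔ M * (I * I) := by
  have hII : IsIdeal (I * I) := hI.mul hN hI
  have hMI : M * I * I ≤ (I * I * M ⊔ M * (I * I) ⊔ I * M) := by
    refine mul_mul_le_iff.2 fun m hm x hx y hy => ?_
    have e : (m * x) * y = (x * y) * m + m * (x * y) - x * (m * y) := by
      linear_combination (norm := abel) hN.associator_left_symm m x y + hN.mul_right_comm x m y
    rw [e]
    exact sub_mem (Submodule.mem_sup_left (Submodule.add_mem_sup
      (mul_mem_mul (mul_mem_mul hx hy) hm) (mul_mem_mul hm (mul_mem_mul hx hy))))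
      (Submodule.mem_sup_right (mul_mem_mul hx (hM.mul_mem_right y hm)))
  calc M * I * I * I ≤ (I * I * M ⊔ M * (I * I) ⊔ I * M) * I := mul_le_mul_left hMI I
    _ = I * I * M * I ⊔ M * (I * I) * I ⊔ I * I * M := by
      rw [sup_mul, sup_mul, hN.submodule_mul_right_comm I M I]
    _ ≤ I * I * M ⊔ M * (I * I) ⊔ I * I * M :=
      sup_le_sup_right (sup_le_sup (hII.mul hN hM).mul_le_right (hM.mul hN hII).mul_le_right) _
    _ = I * I * M ⊔ M * (I * I) := by rw [sup_right_comm, sup_idem]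

theorem IsIdeal.mul_mul_mul_mul_mul_mul_le (hN : IsNovikov A) {I M : Submodule F A}
    (hI : IsIdeal I) (hM : IsIdeal M) : M * I * I * I * I * I * I ≤ M * (I * I) := by
  have hII : IsIdeal (I * I) := hI.mul hN hI
  have hMII : IsIdeal (M * (I * I)) := hM.mul hN hII
  have hleft : I * I * M * I * I * I ≤ M * (I * I) :=
    calc I * I * M * I * I * I = I * I * I * I * I * M := by
          rw [hN.submodule_mul_right_comm (I * I) M, hN.submodule_mul_right_comm (I * I * I) M,
            hN.submodule_mul_right_comm (I * I * I * I) M]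
      _ ≤ (I * I) * (I * I) * M :=
          mul_le_mul_left ((hI.mul_mul_mul_le hN hII).trans_eq (sup_idem _)) M
      _ ≤ M * (I * I) := hM.mul_self_mul_le hN _
  have hright : M * (I * I) * I * I * I ≤ M * (I * I) :=
    (mul_le_mul_left (mul_le_mul_left hMII.mul_le_right I) I).trans
      ((mul_le_mul_left hMII.mul_le_right I).trans hMII.mul_le_right)
  calc M * I * I * I * I * I * I ≤ (I * I * M ⊔ M * (I * I)) * I * I * I := by
        gcongr
        exact hI.mul_mul_mul_le hN hM
    _ = I * I * M * I * I * I ⊔ M * (I * I) * I * I * I := by simp only [sup_mul]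
    _ ≤ M * (I * I) := sup_le hleft hright

theorem IsRightNilpotent.of_mul_self (hN : IsNovikov A) {I : Submodule F A} (hI : IsIdeal I)
    (h : IsRightNilpotent (I * I)) : IsRightNilpotent I := by
  have key (n : ℕ) : rightPower I (1 + 6 * n) ≤
      rightPower (I * I) n := by
    induction n with
    | zero => exact le_rfl
    | succ n ih =>
      calc rightPower I (1 + 6 * n) * I * I * I * I * I * I
          ≤ rightPower (I * I) n * I * I * I * I * I * I := by gcongr
        _ ≤ rightPower (I * I) n * (I * I) :=
          hI.mul_mul_mul_mul_mul_mul_le hN ((hI.mul hN hI).rightPower hN n)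
  obtain ⟨n, hn⟩ := h
  exact ⟨1 + 6 * n, le_bot_iff.1 (hn ▸ key n)⟩

end RightNilpotent

section LiePowers

variable {F : Type v} [Field F] {A : Type u} [NonUnitalNonAssocRing A] [Module F A]

theorem lie_mem_liePower_succ {n : ℕ} {a b : A} (ha : a ∈ liePower F A n)
    (hb : b ∈ liePower F A n) : ⁅a, b⁆ ∈ liePower F A (n + 1) :=
  Submodule.subset_span ⟨a, ha, b, hb, rfl⟩

theorem lie_mem_liePower_one (a b : A) : ⁅a, b⁆ ∈ liePower F A 1 :=
  lie_mem_liePower_succ (n := 0) (Submodule.mem_top (R := F)) (Submodule.mem_top (R := F))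

variable [IsScalarTower F A A] [SMulCommClass F A A]

theorem isIdeal_liePower (hF : ringChar F ≠ 2) (hN : IsNovikov A) (n : ℕ) :
    IsIdeal (liePower F A n) := by
  induction n with
  | zero => exact ⟨fun _ _ _ => Submodule.mem_top (R := F), fun _ _ _ => Submodule.mem_top (R := F)⟩
  | succ n ih =>
    have lie_mul_mem (c) {a b : A} (ha : a ∈ liePower F A n) (hb : b ∈ liePower F A n) :
        ⁅a, b⁆ * c ∈ liePower F A (n + 1) := by
      rw [← Submodule.smul_mem_iff _ (Ring.two_ne_zero hF), ofNat_smul_eq_nsmul,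
        hN.two_nsmul_lie_mul]
      exact add_mem (lie_mem_liePower_succ (ih.mul_mem_right c ha) hb)
        (lie_mem_liePower_succ ha (ih.mul_mem_right c hb))
    have lie_mem (c) {a : A} (ha : a ∈ liePower F A n) : ⁅c, a⁆ ∈ liePower F A n :=
      sub_mem (ih.mul_mem_left c ha) (ih.mul_mem_right c ha)
    refine isIdeal_span ?_ ?_
    · rintro c _ ⟨a, ha, b, hb, rfl⟩
      rw [← Ring.lie_def, hN.mul_lie]
      exact add_mem (lie_mul_mem c ha hb) (add_mem (lie_mem_liePower_succ (lie_mem c ha) hb)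
        (lie_mem_liePower_succ ha (lie_mem c hb)))
    · rintro c _ ⟨a, ha, b, hb, rfl⟩
      exact lie_mul_mem c ha hb

theorem liePower_antitone (hF : ringChar F ≠ 2) (hN : IsNovikov A) : Antitone (liePower F A) := by
  refine antitone_nat_of_succ_le fun n => Submodule.span_le.2 ?_
  rintro _ ⟨a, ha, b, hb, rfl⟩
  have hI : IsIdeal (liePower F A n) := isIdeal_liePower hF hN n
  exact sub_mem (hI.mul_mem_left a hb) (hI.mul_mem_left b ha)

theorem associator_mem_liePower_succ (hF : ringChar F ≠ 2) (hN : IsNovikov A) {n : ℕ} {a b : A}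
    (ha : a ∈ liePower F A n) (hb : b ∈ liePower F A n) (c : A) :
    associator a b c ∈ liePower F A (n + 1) := by
  rw [hN.associator_eq_lie_mul_sub_lie]
  exact sub_mem ((isIdeal_liePower hF hN (n + 1)).mul_mem_right c (lie_mem_liePower_succ ha hb))
    (lie_mem_liePower_succ ha ((isIdeal_liePower hF hN n).mul_mem_right c hb))

theorem liePower_mul_self_mul_liePower_one_le (hF : ringChar F ≠ 2) (hN : IsNovikov A) (n : ℕ) :
    liePower F A n * liePower F A n * liePower F A 1 ≤ liePower F A (n + 1) := by
  have hI : IsIdeal (liePower F A n) := isIdeal_liePower hF hN n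
  refine mul_mul_le_iff.2 fun i hi j hj c hc => ?_
  have h : liePower F A 1 ≤ (liePower F A (n + 1)).comap (LinearMap.mulLeft F (i * j)) := by
    refine Submodule.span_le.2 ?_
    rintro _ ⟨a, _, b, _, rfl⟩
    change (i * j) * ⁅a, b⁆ ∈ liePower F A (n + 1)
    rw [hN.mul_mul_lie]
    exact sub_mem (associator_mem_liePower_succ hF hN (hI.mul_mem_left b hj) hi a)
      (associator_mem_liePower_succ hF hN (hI.mul_mem_left a hj) hi b)
  exact h hc

theorem IsRightNilpotent.of_liePower_succ (hF : ringChar F ≠ 2) (hN : IsNovikov A) {n : ℕ}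
    (h : IsRightNilpotent (liePower F A (n + 2))) : IsRightNilpotent (liePower F A (n + 1)) := by
  set I := liePower F A (n + 1)
  have hI : IsIdeal I := isIdeal_liePower hF hN (n + 1)
  have hfour : I * I * (I * I) ≤ liePower F A (n + 2) :=
    calc I * I * (I * I) ≤ I * I * liePower F A 1 :=
          mul_le_mul_right (hI.mul_le_left.trans (liePower_antitone hF hN (by omega))) _
      _ ≤ liePower F A (n + 2) := liePower_mul_self_mul_liePower_one_le hF hN (n + 1)
  exact .of_mul_self hN hI (.of_mul_self hN (hI.mul hN hI) (h.mono hfour))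

theorem IsLieSolvable.isRightNilpotent_liePower_one (hF : ringChar F ≠ 2) (hN : IsNovikov A)
    (hL : IsLieSolvable F A) : IsRightNilpotent (liePower F A 1) := by
  obtain ⟨n, hn⟩ := hL
  have hnil : IsRightNilpotent (liePower F A (n + 1)) :=
    .mono (liePower_antitone hF hN n.le_succ) ⟨0, hn⟩
  clear hn
  induction n with
  | zero => exact hnil
  | succ n ih => exact ih (.of_liePower_succ hF hN hnil)

end LiePowers

section Quasiregular

variable {A : Type u} [NonUnitalNonAssocRing A]

/-- Left quasiregularity of a single element, as opposed to that of the whole algebra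
(`IsLeftQuasiregular`). -/
def LeftQuasiregular (x : A) : Prop := ∃ y : A, x + y = y * x

theorem LeftQuasiregular.map {B : Type w} [NonUnitalNonAssocRing B] {G : Type*} [FunLike G A B]
    [NonUnitalRingHomClass G A B] {x : A} (hx : LeftQuasiregular x) (f : G) :
    LeftQuasiregular (f x) := by
  obtain ⟨y, hy⟩ := hx
  exact ⟨f y, by rw [← map_add, hy, map_mul]⟩

theorem IsNovikov.not_leftQuasiregular_of_mul_eq_self (hN : IsNovikov A)
    (hcomm : ∀ a b : A, a * b = b * a) {h e : A} (hh : h ≠ 0) (he : h * e = h) :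
    ¬ LeftQuasiregular e := by
  rintro ⟨y, hy⟩
  have hhy : h + h * y = h * y :=
    calc h + h * y = h * (e + y) := by rw [mul_add, he]
      _ = (h * e) * y := by rw [hy, hcomm y e, hN.mul_assoc_of_comm hcomm]
      _ = h * y := by rw [he]
  exact hh (add_eq_right.1 hhy)

variable {F : Type v} [Field F] [Module F A]

theorem AlgIdeal.isLeftQuasiregular_toSubalgebra_iff (I : AlgIdeal F A) :
    IsLeftQuasiregular I.toSubalgebra ↔ ∀ x ∈ I.toSubmodule, LeftQuasiregular x := by
  refine ⟨fun h x hx => LeftQuasiregular.map (h ⟨x, hx⟩)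
    (NonUnitalSubalgebraClass.subtype I.toSubalgebra), fun h ⟨x, hx⟩ => ?_⟩
  obtain ⟨y, hy⟩ := h x hx
  have hyI : y ∈ I.toSubmodule := by
    rw [eq_sub_of_add_eq' hy]
    exact sub_mem (I.mul_mem_left y hx) hx
  exact ⟨⟨y, hyI⟩, Subtype.ext hy⟩

variable [IsScalarTower F A A]

variable (F) in
/-- The operator `a ↦ a - a * x`, that is, right multiplication by `1 - x` in the unitization; its
range detects the left quasiregularity of `x`. -/
def mulRightOneSub (x : A) : A →ₗ[F] A := LinearMap.id - LinearMap.mulRight F x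

theorem mulRightOneSub_apply (x a : A) : mulRightOneSub F x a = a - a * x := rfl

theorem leftQuasiregular_iff_mem_range_mulRightOneSub {x : A} :
    LeftQuasiregular x ↔ x ∈ LinearMap.range (mulRightOneSub F x) := by
  constructor
  · rintro ⟨y, hy⟩
    refine ⟨-y, ?_⟩
    rw [mulRightOneSub_apply, neg_mul]
    linear_combination (norm := abel) -hy
  · rintro ⟨y, hy⟩
    rw [mulRightOneSub_apply] at hy
    refine ⟨-y, ?_⟩
    rw [neg_mul]
    linear_combination (norm := abel) -hy

theorem IsNovikov.mulRightOneSub_mul (hN : IsNovikov A) (x a b : A) :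
    mulRightOneSub F x (a * b) = mulRightOneSub F x a * b := by
  simp only [mulRightOneSub_apply, sub_mul, hN.mul_right_comm a b x]

theorem IsNovikov.mulRightOneSub_mul_left (hN : IsNovikov A) (x y m : A) :
    mulRightOneSub F x (y * m) = (x + y - y * x) * m - x * m := by
  simp only [mulRightOneSub_apply, sub_mul, add_mul, hN.mul_right_comm y m x]
  abel

theorem isIdeal_range_mulRightOneSub_sup (hN : IsNovikov A) {C : Submodule F A} (hC : IsIdeal C)
    (hlie : ∀ a b : A, ⁅a, b⁆ ∈ C) (x : A) :
    IsIdeal (LinearMap.range (mulRightOneSub F x) ⊔ C) := by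
  have mul_mem_right (a : A) {z : A} (hz : z ∈ LinearMap.range (mulRightOneSub F x) ⊔ C) :
      z * a ∈ LinearMap.range (mulRightOneSub F x) ⊔ C := by
    obtain ⟨_, ⟨b, rfl⟩, c, hc, rfl⟩ := Submodule.mem_sup.1 hz
    rw [add_mul]
    exact Submodule.add_mem_sup ⟨b * a, hN.mulRightOneSub_mul x b a⟩ (hC.mul_mem_right a hc)
  refine ⟨fun a z hz => ?_, mul_mem_right⟩
  rw [← sub_add_cancel (a * z) (z * a)]
  exact add_mem (Submodule.mem_sup_right (hlie a z)) (mul_mem_right a hz)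

variable [SMulCommClass F A A]

theorem IsNovikov.range_mulRightOneSub_mul_le (hN : IsNovikov A) (x : A) (M : Submodule F A) :
    LinearMap.range (mulRightOneSub F x) * M ≤ LinearMap.range (mulRightOneSub F x) := by
  refine mul_le_iff.2 ?_
  rintro _ ⟨a, rfl⟩ m -
  exact ⟨a * m, hN.mulRightOneSub_mul x a m⟩

section Lifting

variable {x y : A} {C : Submodule F A}

theorem IsNovikov.mul_mem_range_mulRightOneSub_sup (hN : IsNovikov A) (hC : IsIdeal C)
    (hyx : x + y - y * x ∈ C) (hxy : x + y - x * y ∈ C) {M : Submodule F A} (hM : IsIdeal M)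
    {u : A} (hu : u ∈ M) : y * u ∈ LinearMap.range (mulRightOneSub F x) ⊔ C * M := by
  let P := mulRightOneSub F x
  have hyxu : (x + y - y * x) * u ∈ C * M := mul_mem_mul hyx hu
  have e : y * u = P (y * u - (y * u) * y) +
      ((x + y - x * y) * u - (x + y - y * x) * u + ((x + y - y * x) * u) * y) := by
    have h₁ : P (y * u) = (x + y - y * x) * u - x * u := hN.mulRightOneSub_mul_left x y u
    have h₂ : x * u - (x * u) * y = (x + y - x * y) * u - y * u := by
      rw [← add_comm y x]
      exact hN.mulRightOneSub_mul_left (F := F) y x u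
    rw [map_sub, hN.mulRightOneSub_mul x (y * u) y, h₁, sub_mul _ (x * u)]
    linear_combination (norm := abel) h₂
  rw [e]
  exact Submodule.add_mem_sup ⟨_, rfl⟩ (add_mem (sub_mem (mul_mem_mul hxy hu) hyxu)
    ((hC.mul hN hM).mul_mem_right y hyxu))

theorem IsNovikov.le_range_mulRightOneSub_sup (hN : IsNovikov A) (hC : IsIdeal C)
    (hyx : x + y - y * x ∈ C) (hxy : x + y - x * y ∈ C) {M : Submodule F A} (hM : IsIdeal M) :
    M ≤ LinearMap.range (mulRightOneSub F x) ⊔ C * M ⊔ M * C := by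
  intro m hm
  have e : m = m * (x + y - y * x) +
      (mulRightOneSub F x (m - m * y + y * m) - y * (m - m * x)) := by
    simp only [mulRightOneSub_apply, add_mul, mul_add, sub_mul, mul_sub]
    linear_combination (norm := abel) -hN.associator_left_symm m y x
  rw [e]
  exact add_mem (Submodule.mem_sup_right (mul_mem_mul hm hyx)) (Submodule.mem_sup_left
    (sub_mem (Submodule.mem_sup_left ⟨_, rfl⟩)
      (hN.mul_mem_range_mulRightOneSub_sup hC hyx hxy hM (sub_mem hm (hM.mul_mem_right x hm)))))

theorem IsNovikov.le_range_mulRightOneSub_sup_mul (hN : IsNovikov A) (hC : IsIdeal C)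
    (hyx : x + y - y * x ∈ C) (hxy : x + y - x * y ∈ C) {M : Submodule F A} (hM : IsIdeal M) :
    M ≤ LinearMap.range (mulRightOneSub F x) ⊔ M * C := by
  have hCC : C ≤ LinearMap.range (mulRightOneSub F x) ⊔ C * C := by
    simpa only [sup_assoc, sup_idem] using hN.le_range_mulRightOneSub_sup hC hyx hxy hC
  have hCM : C * M ≤ LinearMap.range (mulRightOneSub F x) ⊔ M * C :=
    calc C * M ≤ (LinearMap.range (mulRightOneSub F x) ⊔ C * C) * M := mul_le_mul_left hCC M
      _ = LinearMap.range (mulRightOneSub F x) * M ⊔ C * C * M := sup_mul _ _ _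
      _ ≤ LinearMap.range (mulRightOneSub F x) ⊔ M * C :=
        sup_le_sup (hN.range_mulRightOneSub_mul_le x M) (hM.mul_self_mul_le hN C)
  exact (hN.le_range_mulRightOneSub_sup hC hyx hxy hM).trans
    (sup_le (sup_le le_sup_left hCM) le_sup_right)

theorem IsNovikov.le_range_mulRightOneSub (hN : IsNovikov A) (hC : IsIdeal C)
    (hnil : IsRightNilpotent C) (hyx : x + y - y * x ∈ C) (hxy : x + y - x * y ∈ C) :
    C ≤ LinearMap.range (mulRightOneSub F x) := by
  have key (n : ℕ) : C ≤ LinearMap.range (mulRightOneSub F x) ⊔ rightPower C n := by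
    induction n with
    | zero => exact le_sup_right
    | succ n ih => exact ih.trans (sup_le le_sup_left
        (hN.le_range_mulRightOneSub_sup_mul hC hyx hxy (hC.rightPower hN n)))
  obtain ⟨n, hn⟩ := hnil
  simpa only [hn, sup_bot_eq] using key n

theorem IsNovikov.leftQuasiregular_of_isRightNilpotent (hN : IsNovikov A) (hC : IsIdeal C)
    (hnil : IsRightNilpotent C) (hyx : x + y - y * x ∈ C) (hxy : x + y - x * y ∈ C) :
    LeftQuasiregular x := by
  have e : (x + y - y * x) + mulRightOneSub F x (-y) = x := by
    rw [mulRightOneSub_apply, neg_mul]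
    abel
  have h := add_mem (hN.le_range_mulRightOneSub hC hnil hyx hxy hyx)
    (LinearMap.mem_range_self (mulRightOneSub F x) (-y))
  rw [e] at h
  exact leftQuasiregular_iff_mem_range_mulRightOneSub.2 h

theorem IsLieSolvable.leftQuasiregular_of_mem_liePower_one (hF : ringChar F ≠ 2)
    (hN : IsNovikov A) (hL : IsLieSolvable F A) (hyx : x + y - y * x ∈ liePower F A 1) :
    LeftQuasiregular x := by
  refine hN.leftQuasiregular_of_isRightNilpotent (isIdeal_liePower hF hN 1)
    (hL.isRightNilpotent_liePower_one hF hN) hyx ?_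
  have e : x + y - x * y = (x + y - y * x) + ⁅y, x⁆ := by
    rw [Ring.lie_def]
    abel
  exact e ▸ add_mem hyx (lie_mem_liePower_one y x)

theorem IsLieSolvable.leftQuasiregular_of_add_sub_mul (hF : ringChar F ≠ 2) (hN : IsNovikov A)
    (hL : IsLieSolvable F A) (h : LeftQuasiregular (x + y - y * x)) : LeftQuasiregular x := by
  obtain ⟨k, hk⟩ := h
  -- In the unitization, `(1 - k) * (1 - y)` is `1 - (y + k - k * y)`.
  have e : x + (y + k - k * y) - (y + k - k * y) * x = associator k y x := by
    simp only [associator_apply, add_mul, sub_mul, mul_add, mul_sub] at hk ⊢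
    linear_combination (norm := abel) hk
  refine hL.leftQuasiregular_of_mem_liePower_one hF hN (y := y + k - k * y) ?_
  rw [e]
  exact associator_mem_liePower_succ (n := 0) hF hN (Submodule.mem_top (R := F))
    (Submodule.mem_top (R := F)) x

end Lifting

end Quasiregular

section Homomorphisms

variable {A : Type u} [NonUnitalNonAssocRing A] {B : Type w} [NonUnitalNonAssocRing B]

theorem IsNovikov.of_surjective {G : Type*} [FunLike G A B] [NonUnitalRingHomClass G A B]
    (hN : IsNovikov A) (f : G) (hf : Function.Surjective f) : IsNovikov B := by
  constructor
  · refine hf.forall₃.2 fun x y z => ?_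
    simp only [associator_apply, ← map_mul, ← map_sub, hN.associator_left_symm x y z]
  · refine hf.forall₃.2 fun x y z => ?_
    simp only [← map_mul, hN.mul_right_comm x y z]

theorem IsNovikov.of_injective {G : Type*} [FunLike G A B] [NonUnitalRingHomClass G A B]
    (hN : IsNovikov B) (f : G) (hf : Function.Injective f) : IsNovikov A := by
  constructor
  · refine fun x y z => hf ?_
    simp only [associator_apply, map_mul, map_sub]
    exact hN.associator_left_symm _ _ _
  · refine fun x y z => hf ?_
    simp only [map_mul]
    exact hN.mul_right_comm _ _ _

variable {F : Type v} [Field F] [Module F A] [Module F B]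

theorem liePower_le_map_of_surjective (f : A →ₙₐ[F] B) (hf : Function.Surjective f) (n : ℕ) :
    liePower F B n ≤ (liePower F A n).map (f : A →ₗ[F] B) := by
  induction n with
  | zero =>
    intro b _
    obtain ⟨a, rfl⟩ := hf b
    exact ⟨a, Submodule.mem_top (R := F), rfl⟩
  | succ n ih =>
    refine Submodule.span_le.2 ?_
    rintro _ ⟨_, ha, _, hb, rfl⟩
    obtain ⟨a, ha', rfl⟩ := ih ha
    obtain ⟨b, hb', rfl⟩ := ih hb
    refine ⟨⁅a, b⁆, lie_mem_liePower_succ ha' hb', ?_⟩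
    change f (a * b - b * a) = f a * f b - f b * f a
    rw [map_sub, map_mul, map_mul]

theorem liePower_le_comap (f : A →ₙₐ[F] B) (n : ℕ) :
    liePower F A n ≤ (liePower F B n).comap (f : A →ₗ[F] B) := by
  induction n with
  | zero => exact fun _ _ => Submodule.mem_top (R := F)
  | succ n ih =>
    refine Submodule.span_le.2 ?_
    rintro _ ⟨a, ha, b, hb, rfl⟩
    change f (a * b - b * a) ∈ liePower F B (n + 1)
    rw [map_sub, map_mul, map_mul]
    exact lie_mem_liePower_succ (show f a ∈ liePower F B n from ih ha)
      (show f b ∈ liePower F B n from ih hb)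

theorem IsLieSolvable.of_surjective (hL : IsLieSolvable F A) (f : A →ₙₐ[F] B)
    (hf : Function.Surjective f) : IsLieSolvable F B := by
  obtain ⟨n, hn⟩ := hL
  refine ⟨n, le_bot_iff.1 ((liePower_le_map_of_surjective f hf n).trans ?_)⟩
  rw [hn, Submodule.map_bot]

theorem IsLieSolvable.of_injective (hL : IsLieSolvable F B) (f : A →ₙₐ[F] B)
    (hf : Function.Injective f) : IsLieSolvable F A := by
  obtain ⟨n, hn⟩ := hL
  refine ⟨n, le_bot_iff.1 ((liePower_le_comap f n).trans ?_)⟩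
  rw [hn]
  exact (LinearMap.ker_eq_bot.2 hf).le

theorem AlgIdeal.isNovikov_toSubalgebra (I : AlgIdeal F A) (hN : IsNovikov A) :
    IsNovikov I.toSubalgebra :=
  hN.of_injective (NonUnitalSubalgebraClass.subtype I.toSubalgebra) Subtype.val_injective

theorem AlgIdeal.isLieSolvable_toSubalgebra (I : AlgIdeal F A) (hL : IsLieSolvable F A) :
    IsLieSolvable F I.toSubalgebra :=
  hL.of_injective (NonUnitalSubalgebraClass.subtype I.toSubalgebra) Subtype.val_injective

/-- The quotient map `AlgIdeal.proj` as an algebra homomorphism. -/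
def AlgIdeal.projHom (I : AlgIdeal F A) : A →ₙₐ[F] I.Quotient :=
  { I.proj with
    map_zero' := map_zero I.proj
    map_mul' := I.proj_mul }

theorem AlgIdeal.proj_eq_zero_iff (I : AlgIdeal F A) (a : A) :
    I.proj a = 0 ↔ a ∈ I.toSubmodule := by
  rw [← map_zero I.proj, I.proj_eq_proj_iff, sub_zero]

theorem AlgIdeal.comap_proj_le_toSubmodule_iff (I : AlgIdeal F A) {N : Submodule F I.Quotient} :
    N.comap I.proj ≤ I.toSubmodule ↔ N = ⊥ := by
  refine ⟨fun h => (Submodule.eq_bot_iff _).2 fun b hb => ?_, ?_⟩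
  · obtain ⟨a, rfl⟩ := I.proj_surjective b
    exact (I.proj_eq_zero_iff a).2 (h hb)
  · rintro rfl a ha
    exact (I.proj_eq_zero_iff a).1 ha

end Homomorphisms

section IdempotentHeart

variable {F : Type v} [Field F] {B : Type u} [NonUnitalNonAssocRing B] [Module F B]

theorem isIrreducibleWithIdempotentHeart_of_forall_mem (hN : IsNovikov B) {e : B} (he : e ≠ 0)
    (hunit : ∀ b : B, b * e = b)
    (hmem : ∀ I : AlgIdeal F B, I.toSubmodule ≠ ⊥ → e ∈ I.toSubmodule) :
    IsIrreducibleWithIdempotentHeart F B := by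
  have heart_eq_top : heart F B = ⊤ := by
    refine top_le_iff.1 (le_sInf ?_)
    rintro _ ⟨I, hI, rfl⟩ b -
    exact hunit b ▸ I.mul_mem_left b (hmem I hI)
  refine ⟨hN, fun h => he ?_, ?_⟩
  · rw [← Submodule.mem_bot F, ← h, heart_eq_top]
    exact Submodule.mem_top
  · rw [HasIdempotentHeart, heart_eq_top, eq_top_iff]
    exact fun b _ => Submodule.subset_span ⟨b, trivial, e, trivial, (hunit b).symm⟩

theorem isIrreducibleWithIdempotentHeart_quotient (hN : IsNovikov B) {x : B} {I : AlgIdeal F B}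
    (hunit : ∀ y, y - y * x ∈ I.toSubmodule)
    (hmax : Maximal (fun V : Submodule F B => IsIdeal V ∧ x ∉ V) I.toSubmodule) :
    IsIrreducibleWithIdempotentHeart F I.Quotient := by
  refine isIrreducibleWithIdempotentHeart_of_forall_mem (e := I.proj x)
    (hN.of_surjective I.projHom I.proj_surjective) ?_ ?_ fun N hN0 => ?_
  · exact fun h => hmax.prop.2 ((I.proj_eq_zero_iff x).1 h)
  · refine I.proj_surjective.forall.2 fun y => ?_
    rw [← I.proj_mul, eq_comm, I.proj_eq_proj_iff]
    exact hunit y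
  · by_contra hx
    refine hN0 (I.comap_proj_le_toSubmodule_iff.1 (hmax.2 ⟨N.isIdeal.comap I.projHom, hx⟩ ?_))
    intro a ha
    rw [Submodule.mem_comap, (I.proj_eq_zero_iff a).2 ha]
    exact zero_mem N.toSubmodule

variable [SMulCommClass F B B]

theorem IsIdeal.map_mulLeft (hN : IsNovikov B) (hcomm : ∀ a b : B, a * b = b * a)
    {S : Submodule F B} (hS : IsIdeal S) (h : B) : IsIdeal (S.map (LinearMap.mulLeft F h)) := by
  have mul_mem_right (a : B) {x : B} (hx : x ∈ S.map (LinearMap.mulLeft F h)) :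
      x * a ∈ S.map (LinearMap.mulLeft F h) := by
    obtain ⟨s, hs, rfl⟩ := hx
    exact ⟨s * a, hS.mul_mem_right a hs, (hN.mul_assoc_of_comm hcomm h s a).symm⟩
  exact ⟨fun a x hx => hcomm x a ▸ mul_mem_right a hx, mul_mem_right⟩

variable [IsScalarTower F B B]

theorem HasIdempotentHeart.heart_le_mul_self (h : HasIdempotentHeart F B) :
    heart F B ≤ heart F B * heart F B := by
  refine h.ge.trans (Submodule.span_le.2 ?_)
  rintro _ ⟨a, ha, b, hb, rfl⟩
  exact mul_mem_mul ha hb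

theorem IsIrreducibleWithIdempotentHeart.eq_bot_of_isRightNilpotent
    (hB : IsIrreducibleWithIdempotentHeart F B) {C : Submodule F B} (hC : IsIdeal C)
    (hnil : IsRightNilpotent C) : C = ⊥ := by
  by_contra hne
  exact hB.2.1 ((hnil.mono (hC.heart_le hne)).eq_bot_of_le_mul_self hB.2.2.heart_le_mul_self)

theorem IsIrreducibleWithIdempotentHeart.mul_comm (hF : ringChar F ≠ 2)
    (hB : IsIrreducibleWithIdempotentHeart F B) (hL : IsLieSolvable F B) (a b : B) :
    a * b = b * a := by
  have h : liePower F B 1 = ⊥ := hB.eq_bot_of_isRightNilpotent (isIdeal_liePower hF hB.1 1)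
    (hL.isRightNilpotent_liePower_one hF hB.1)
  rw [← sub_eq_zero, ← Submodule.mem_bot F, ← h]
  exact lie_mem_liePower_one a b

theorem IsIrreducibleWithIdempotentHeart.exists_mul_eq_self
    (hB : IsIrreducibleWithIdempotentHeart F B) (hcomm : ∀ a b : B, a * b = b * a) :
    ∃ h e : B, h ≠ 0 ∧ h * e = h := by
  obtain ⟨hN, hne, hidem⟩ := hB
  obtain ⟨h, hh, k, hk, hhk⟩ : ∃ h ∈ heart F B, ∃ k ∈ heart F B, h * k ≠ 0 := by
    by_contra! hzero
    refine hne (le_bot_iff.1 (hidem.heart_le_mul_self.trans (mul_le_iff.2 fun a ha b hb => ?_)))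
    exact (Submodule.mem_bot F).2 (hzero a ha b hb)
  have hmap : (heart F B).map (LinearMap.mulLeft F h) ≠ ⊥ :=
    (Submodule.ne_bot_iff _).2 ⟨h * k, ⟨k, hk, rfl⟩, hhk⟩
  obtain ⟨e, -, he⟩ := (isIdeal_heart.map_mulLeft hN hcomm h).heart_le hmap hh
  exact ⟨h, e, left_ne_zero_of_mul hhk, he⟩

theorem IsIrreducibleWithIdempotentHeart.not_isLeftQuasiregular (hF : ringChar F ≠ 2)
    (hB : IsIrreducibleWithIdempotentHeart F B) (hL : IsLieSolvable F B) :
    ¬ IsLeftQuasiregular B := by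
  have hcomm := hB.mul_comm hF hL
  obtain ⟨h, e, hh, he⟩ := hB.exists_mul_eq_self hcomm
  exact fun hq => hB.1.not_leftQuasiregular_of_mul_eq_self hcomm hh he (hq e)

end IdempotentHeart

section Radical

variable {F : Type v} [Field F] {A : Type u} [NonUnitalNonAssocRing A] [Module F A]

theorem IsLeftQuasiregular.of_surjective {B : Type w} [NonUnitalNonAssocRing B] {G : Type*}
    [FunLike G A B] [NonUnitalRingHomClass G A B] (hq : IsLeftQuasiregular A) (f : G)
    (hf : Function.Surjective f) : IsLeftQuasiregular B :=
  hf.forall.2 fun x => LeftQuasiregular.map (hq x) f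

theorem IsLeftQuasiregular.isAndrunakievichRadical (hF : ringChar F ≠ 2) (hN : IsNovikov A)
    (hL : IsLieSolvable F A) (hq : IsLeftQuasiregular A) : IsAndrunakievichRadical F A :=
  ⟨hN, fun _ _ _ _ _ f hf hB =>
    hB.not_isLeftQuasiregular hF (hL.of_surjective f hf) (hq.of_surjective f hf)⟩

theorem AlgIdeal.le_quasiregularRadical (I : AlgIdeal F A)
    (hq : IsLeftQuasiregular I.toSubalgebra) :
    I.toSubmodule ≤ (quasiregularRadical F A).toSubmodule :=
  le_sSup ⟨I, hq, rfl⟩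

variable [IsScalarTower F A A] [SMulCommClass F A A]

theorem IsAndrunakievichRadical.isLeftQuasiregular (hF : ringChar F ≠ 2)
    (hL : IsLieSolvable F A) (hA : IsAndrunakievichRadical F A) : IsLeftQuasiregular A := by
  obtain ⟨hN, hA⟩ := hA
  intro x
  have hx : x ∈ LinearMap.range (mulRightOneSub F x) ⊔ liePower F A 1 := by
    by_contra hx
    obtain ⟨W, hle, hmax⟩ := exists_maximal_isIdeal_notMem
      (isIdeal_range_mulRightOneSub_sup hN (isIdeal_liePower hF hN 1) lie_mem_liePower_one x) hx
    let I : AlgIdeal F A := hmax.prop.1.toAlgIdeal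
    exact hA _ I.projHom I.proj_surjective (isIrreducibleWithIdempotentHeart_quotient hN
      (fun y => hle (Submodule.mem_sup_left ⟨y, rfl⟩)) hmax)
  obtain ⟨_, ⟨y, rfl⟩, c, hc, hyc⟩ := Submodule.mem_sup.1 hx
  have e : x + -y - -y * x = c := by
    rw [mulRightOneSub_apply] at hyc
    rw [neg_mul]
    linear_combination (norm := abel) -hyc
  exact hL.leftQuasiregular_of_mem_liePower_one hF hN (e ▸ hc)

theorem isLeftQuasiregular_iff_isAndrunakievichRadical (hF : ringChar F ≠ 2) (hN : IsNovikov A)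
    (hL : IsLieSolvable F A) : IsLeftQuasiregular A ↔ IsAndrunakievichRadical F A :=
  ⟨fun h => h.isAndrunakievichRadical hF hN hL, fun h => h.isLeftQuasiregular hF hL⟩

theorem leftQuasiregular_add_of_mem_quasiregularRadical (hF : ringChar F ≠ 2) (hN : IsNovikov A)
    (hL : IsLieSolvable F A) {x z : A} (hx : x ∈ (quasiregularRadical F A).toSubmodule)
    (hz : LeftQuasiregular z) : LeftQuasiregular (z + x) := by
  change x ∈ sSup _ at hx
  rw [sSup_eq_iSup'] at hx
  refine Submodule.iSup_induction _ hx
    (motive := fun x => ∀ z, LeftQuasiregular z → LeftQuasiregular (z + x)) ?_ ?_ ?_ z hz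
  · rintro ⟨_, I, hI, rfl⟩ x hx z ⟨w, hw⟩
    have e : z + x + w - w * (z + x) = x - w * x := by
      rw [mul_add]
      linear_combination (norm := abel) hw
    refine hL.leftQuasiregular_of_add_sub_mul hF hN (y := w) ?_
    rw [e]
    exact I.isLeftQuasiregular_toSubalgebra_iff.1 hI _ (sub_mem hx (I.mul_mem_left w hx))
  · exact fun z hz => (add_zero z).symm ▸ hz
  · exact fun x y hx hy z hz => add_assoc z x y ▸ hy _ (hx z hz)

theorem isLeftQuasiregular_quasiregularRadical (hF : ringChar F ≠ 2) (hN : IsNovikov A)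
    (hL : IsLieSolvable F A) : IsLeftQuasiregular (quasiregularRadical F A).toSubalgebra := by
  rw [AlgIdeal.isLeftQuasiregular_toSubalgebra_iff]
  intro x hx
  have hzero : LeftQuasiregular (0 : A) := ⟨0, by simp only [add_zero, mul_zero]⟩
  exact zero_add x ▸ leftQuasiregular_add_of_mem_quasiregularRadical hF hN hL hx hzero

theorem AlgIdeal.isLeftQuasiregular_comap_proj (hF : ringChar F ≠ 2) (hN : IsNovikov A)
    (hL : IsLieSolvable F A) {J : AlgIdeal F A} (hJ : IsLeftQuasiregular J.toSubalgebra)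
    {N : AlgIdeal F J.Quotient} (hq : IsLeftQuasiregular N.toSubalgebra) :
    IsLeftQuasiregular (N.isIdeal.comap J.projHom).toAlgIdeal.toSubalgebra := by
  rw [isLeftQuasiregular_toSubalgebra_iff] at hJ hq ⊢
  intro x hx
  obtain ⟨y, hy⟩ := hq (J.proj x) hx
  obtain ⟨y, rfl⟩ := J.proj_surjective y
  rw [← map_add, ← J.proj_mul, J.proj_eq_proj_iff] at hy
  exact hL.leftQuasiregular_of_add_sub_mul hF hN (hJ _ hy)

theorem eq_bot_of_isLeftQuasiregular_quotient (hF : ringChar F ≠ 2) (hN : IsNovikov A)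
    (hL : IsLieSolvable F A) {N : AlgIdeal F (quasiregularRadical F A).Quotient}
    (hq : IsLeftQuasiregular N.toSubalgebra) : N.toSubmodule = ⊥ := by
  have hK := AlgIdeal.isLeftQuasiregular_comap_proj hF hN hL
    (isLeftQuasiregular_quasiregularRadical hF hN hL) hq
  exact (AlgIdeal.comap_proj_le_toSubmodule_iff _).1 (AlgIdeal.le_quasiregularRadical _ hK)

end Radical

end NovikovRadicals

open NovikovRadicals in
theorem theorem3 {F : Type v} [Field F] (hF : ringChar F ≠ 2)
    {A : Type u} [NonUnitalNonAssocRing A] [Module F A] [IsScalarTower F A A]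
    [SMulCommClass F A A] (hN : IsNovikov A) (hL : IsLieSolvable F A) :
    (IsLeftQuasiregular A ↔ IsAndrunakievichRadical F A) ∧
    -- the sum `J` of all left-quasiregular ideals is left-quasiregular
    IsLeftQuasiregular (quasiregularRadical F A).toSubalgebra ∧
    -- the quotient `A / J` has no nonzero left-quasiregular ideal
    (∀ L : AlgIdeal F (quasiregularRadical F A).Quotient,
      IsLeftQuasiregular L.toSubalgebra → L.toSubmodule = ⊥) ∧
    -- `J` is the largest Andrunakievich-radical ideal
    IsAndrunakievichRadical F (quasiregularRadical F A).toSubalgebra ∧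
    (∀ I : AlgIdeal F A, IsAndrunakievichRadical F I.toSubalgebra →
      I.toSubmodule ≤ (quasiregularRadical F A).toSubmodule) := by
  set J := quasiregularRadical F A
  have hJ : IsLeftQuasiregular J.toSubalgebra := isLeftQuasiregular_quasiregularRadical hF hN hL
  refine ⟨isLeftQuasiregular_iff_isAndrunakievichRadical hF hN hL, hJ,
    fun _ => eq_bot_of_isLeftQuasiregular_quotient hF hN hL, ?_, fun I hI => ?_⟩
  · exact hJ.isAndrunakievichRadical hF (J.isNovikov_toSubalgebra hN)
      (J.isLieSolvable_toSubalgebra hL)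
  · exact I.le_quasiregularRadical (hI.isLeftQuasiregular hF (I.isLieSolvable_toSubalgebra hL))
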